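/- Let $K$ be a compact line, i.e. a linearly ordered set which is compact in its order topology, and let $C(K)$ be the Banach space of continuous real-valued functions on $K$ with the supremum norm. Let $X$ be a closed linear subspace of $C(K)$ whose dual space $X^*$ is separable in the norm topology. Then $X$ has the $c_0$-extension property in $C(K)$: every bounded linear operator $T:X\to c_0$ extends to a bounded linear operator $T':C(K)\to c_0$, where $c_0$ is the Banach space of real sequences converging to $0$, with the supremum norm. Moreover, for every bounded linear operator $T:X\to c_0$ and every $\varepsilon>0$, the extension $T'$ can be chosen with $\|T'\|\le(8+\varepsilon)\|T\|$. -/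

import Mathlib

open scoped ZeroAtInfty

/-- Linear subspaces of a real normed space. This is just `Submodule ℝ E`, with the additive and
scalar structure of `E` read off from its normed space structure, so that every subspace carries
the restricted norm. -/
abbrev NormedSubspace (E : Type*) [NormedAddCommGroup E] [NormedSpace ℝ E] : Type _ :=
  Submodule ℝ E

/-- A linear subspace `Y` of a real normed space `E` has the `c₀`-extension property in `E` if
every bounded operator from `Y` to `c₀` extends to a bounded operator from `E` to `c₀`.
The space `c₀` of real null sequences with the supremum norm is `C₀(ℕ, ℝ)`, the continuous
functions vanishing at infinity on the discrete space `ℕ`. -/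
def HasC0ExtensionProperty {E : Type*} [NormedAddCommGroup E] [NormedSpace ℝ E]
    (Y : NormedSubspace E) : Prop :=
  ∀ T : Y →L[ℝ] C₀(ℕ, ℝ), ∃ T' : E →L[ℝ] C₀(ℕ, ℝ), ∀ y : Y, T' (y : E) = T y

open Filter Topology

open scoped BoundedContinuousFunction

/-! Separability of `X*` covers `K` by countably many closed sets, on each of which the evaluations
on `X` stay within 1/8 of one functional `g i`. Composition with an order retraction onto the union
of the first `m` sets gives contractions `Q m`, nearly of finite rank on `X`. The retraction need
not be continuous, so their values are merely bounded functions. They converge strongly to the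
inclusion `J` because finitely many points of the line control a continuous function
(`exists_order_retraction_operators`). By Sobczyk's argument the coordinates of `T` extend to
functionals `F n` on the bounded functions, null at the countably many vectors `w m j`. If `k n`
grows slowly enough, the functionals `F n ∘ (J - Q (k n))` are pointwise null, bounded by `4‖T‖`,
and extend `T` up to an error `‖T‖/2` (`exists_approx_extension`). Correcting the error repeatedly
costs a factor 2, hence 8. -/

/-! ### Null sequences of functionals and Sobczyk's theorem. -/

/-- A sequence of functionals which is bounded and pointwise null defines an operator into `c₀`. -/
theorem exists_clm_zeroAtInfty_of_tendsto {E : Type*} [NormedAddCommGroup E] [NormedSpace ℝ E]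
    (g : ℕ → StrongDual ℝ E) {C : ℝ} (hC : 0 ≤ C) (hg : ∀ n, ‖g n‖ ≤ C)
    (h0 : ∀ e, Tendsto (fun n => g n e) atTop (𝓝 0)) :
    ∃ T : E →L[ℝ] C₀(ℕ, ℝ), (∀ e n, T e n = g n e) ∧ ‖T‖ ≤ C := by
  let L : E →ₗ[ℝ] C₀(ℕ, ℝ) :=
    { toFun := fun e =>
        { toFun := fun n => g n e
          continuous_toFun := continuous_of_discreteTopology
          zero_at_infty' := by
            rw [cocompact_eq_cofinite, Nat.cofinite_eq_atTop]
            exact h0 e }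
      map_add' := fun x y => by
        ext n
        exact map_add (g n) x y
      map_smul' := fun c x => by
        ext n
        exact map_smul (g n) c x }
  have hL : ∀ e, ‖L e‖ ≤ C * ‖e‖ := by
    intro e
    rw [← ZeroAtInftyContinuousMap.norm_toBCF_eq_norm,
      BoundedContinuousFunction.norm_le (by positivity)]
    intro n
    exact (g n).le_of_opNorm_le (hg n) e
  exact ⟨L.mkContinuous C hL, fun _ _ => rfl, L.mkContinuous_norm_le hC hL⟩

/-- If each `P N` holds eventually, then so does `P (k n) n` for a sequence `k n` growing slowly. -/
theorem exists_tendsto_atTop_diagonal {P : ℕ → ℕ → Prop} (h0 : ∀ n, P 0 n)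
    (h : ∀ N, ∀ᶠ n in atTop, P N n) :
    ∃ k : ℕ → ℕ, Tendsto k atTop atTop ∧ ∀ n, P (k n) n := by
  classical
  refine ⟨fun n => Nat.findGreatest (fun N => P N n) n, ?_, fun n => ?_⟩
  · refine tendsto_atTop.2 fun N => ?_
    filter_upwards [h N, eventually_ge_atTop N] with n hn hNn
    exact Nat.le_findGreatest hNn hn
  · exact Nat.findGreatest_spec (P := fun N => P N n) (Nat.zero_le n) (h0 n)

/-- Hahn-Banach along a linear isometry. -/
theorem LinearIsometry.exists_dual_extension {X E : Type*} [NormedAddCommGroup X]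
    [NormedSpace ℝ X] [NormedAddCommGroup E] [NormedSpace ℝ E] (i : X →ₗᵢ[ℝ] E)
    (f : StrongDual ℝ X) : ∃ F : StrongDual ℝ E, (∀ x, F (i x) = f x) ∧ ‖F‖ ≤ ‖f‖ := by
  let e := i.equivRange
  obtain ⟨F, hF, hn⟩ := exists_extension_norm_eq (LinearMap.range i.toLinearMap)
    (f.comp (e.symm : LinearMap.range i.toLinearMap →L[ℝ] X))
  refine ⟨F, fun x => ?_, ?_⟩
  · have := hF (e x)
    simpa [e] using this
  · rw [hn]
    refine ContinuousLinearMap.opNorm_le_bound _ (norm_nonneg _) fun y => ?_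
    refine (f.le_opNorm _).trans (le_of_eq ?_)
    congr 1
    exact e.symm.norm_map y

/-- Sobczyk's theorem: a weak* null sequence of functionals extends, with norms at most doubled, to
a sequence which is null at countably many prescribed further vectors. -/
theorem exists_dual_extension_tendsto_zero {X E : Type*} [NormedAddCommGroup X]
    [NormedSpace ℝ X] [NormedAddCommGroup E] [NormedSpace ℝ E] (i : X →ₗᵢ[ℝ] E)
    (f : ℕ → StrongDual ℝ X) {M : ℝ} (hM : ∀ n, ‖f n‖ ≤ M)
    (hf : ∀ x, Tendsto (fun n => f n x) atTop (𝓝 0)) (w : ℕ → E) :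
    ∃ g : ℕ → StrongDual ℝ E, (∀ n x, g n (i x) = f n x) ∧ (∀ n, ‖g n‖ ≤ 2 * M) ∧
      ∀ j, Tendsto (fun n => g n (w j)) atTop (𝓝 0) := by
  have hM0 : 0 ≤ M := (norm_nonneg _).trans (hM 0)
  choose F hF hFn using fun n => i.exists_dual_extension (f n)
  -- Otherwise take a weak* limit of `F n` along an ultrafilter of bad indices: it vanishes on `X`
  -- because `f` is weak* null, and it serves as `G` for some bad `n`.
  have key : ∀ N, ∀ᶠ n in atTop, ∃ G : StrongDual ℝ E, ‖G‖ ≤ M ∧ (∀ x, G (i x) = 0) ∧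
      ∀ j < N, |F n (w j) - G (w j)| ≤ 1 / ((N : ℝ) + 1) := by
    intro N
    by_contra hN
    have hN' := not_eventually.1 hN
    let l : Filter ℕ := atTop ⊓ 𝓟 {n | ¬ ∃ G : StrongDual ℝ E, ‖G‖ ≤ M ∧ (∀ x, G (i x) = 0) ∧
      ∀ j < N, |F n (w j) - G (w j)| ≤ 1 / ((N : ℝ) + 1)}
    have hl : l.NeBot := frequently_mem_iff_neBot.1 hN'
    let U : Ultrafilter ℕ := Ultrafilter.of l
    have hU : (U : Filter ℕ) ≤ l := Ultrafilter.of_le l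
    obtain ⟨G, hG, hGU⟩ := (WeakDual.isCompact_closedBall (0 : StrongDual ℝ E) M).ultrafilter_le_nhds
      (U.map fun n => StrongDual.toWeakDual (F n)) (by
        simp only [Ultrafilter.coe_map, le_principal_iff, mem_map]
        refine univ_mem' fun n => ?_
        simpa using (hFn n).trans (hM n))
    have hlim : ∀ e, Tendsto (fun n => F n e) U (𝓝 (G e)) := fun e =>
      ((WeakDual.eval_continuous e).tendsto G).comp hGU
    have hev : ∀ᶠ n in (U : Filter ℕ), ∀ j < N, |F n (w j) - G (w j)| ≤ 1 / ((N : ℝ) + 1) := by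
      have : ∀ j ∈ Finset.range N, ∀ᶠ n in (U : Filter ℕ),
          |F n (w j) - G (w j)| ≤ 1 / ((N : ℝ) + 1) := by
        intro j _
        filter_upwards [Metric.tendsto_nhds.1 (hlim (w j)) (1 / ((N : ℝ) + 1)) (by positivity)]
          with n hn
        exact hn.le
      simpa using (Finset.eventually_all (Finset.range N)).2 this
    have hbad : ∀ᶠ n in (U : Filter ℕ), ¬ ∃ G : StrongDual ℝ E, ‖G‖ ≤ M ∧ (∀ x, G (i x) = 0) ∧
        ∀ j < N, |F n (w j) - G (w j)| ≤ 1 / ((N : ℝ) + 1) :=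
      hU (mem_inf_of_right (mem_principal_self _))
    obtain ⟨n, hn, hn'⟩ := (hev.and hbad).exists
    refine hn' ⟨WeakDual.toStrongDual G, by simpa using hG, fun x => ?_, hn⟩
    refine tendsto_nhds_unique (hlim (i x)) ?_
    simp only [hF]
    exact (hf x).mono_left (hU.trans inf_le_left)
  obtain ⟨k, hk, hP⟩ := exists_tendsto_atTop_diagonal
    (fun n => ⟨0, by simpa using hM0, fun _ => rfl, fun j hj => absurd hj (Nat.not_lt_zero j)⟩) key
  choose G hGn hG0 hGw using hP
  refine ⟨fun n => F n - G n, fun n x => by simp [hF, hG0], fun n => ?_, fun j => ?_⟩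
  · have := norm_sub_le (F n) (G n)
    linarith [hFn n, hM n, hGn n]
  · refine squeeze_zero_norm' ?_ ((tendsto_one_div_add_atTop_nhds_zero_nat (𝕜 := ℝ)).comp hk)
    filter_upwards [hk.eventually_gt_atTop j] with n hn
    exact hGw n j hn

/-! ### Approximate extension and iteration. -/

/-- An operator into `c₀` extends approximately to a space on which the inclusion into a larger
space is the strong limit of contractions whose restrictions are nearly of finite rank. -/
theorem exists_approx_extension {X E B : Type*} [NormedAddCommGroup X] [NormedSpace ℝ X]
    [NormedAddCommGroup E] [NormedSpace ℝ E] [NormedAddCommGroup B] [NormedSpace ℝ B]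
    (i : X →ₗᵢ[ℝ] E) (J : E →ₗᵢ[ℝ] B) (Q : ℕ → E →L[ℝ] B) (hQ : ∀ m, ‖Q m‖ ≤ 1) (hQ0 : Q 0 = 0)
    (hQJ : ∀ e, Tendsto (fun m => Q m e) atTop (𝓝 (J e)))
    (g : ℕ → StrongDual ℝ X) (w : ℕ → ℕ → B)
    (hw : ∀ m x, ‖Q m (i x) - ∑ j ∈ Finset.range m, g j x • w m j‖ ≤ 1 / 8 * ‖x‖)
    (T : X →L[ℝ] C₀(ℕ, ℝ)) :
    ∃ S : E →L[ℝ] C₀(ℕ, ℝ), ‖S‖ ≤ 4 * ‖T‖ ∧ ∀ x, ‖T x - S (i x)‖ ≤ 1 / 2 * ‖T‖ * ‖x‖ := by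
  rcases (ContinuousLinearMap.opNorm_nonneg T).eq_or_lt with hT | hM
  · refine ⟨0, ContinuousLinearMap.opNorm_zero.trans_le (by rw [← hT]; simp), fun x => ?_⟩
    have := T.le_opNorm x
    rw [← hT] at this ⊢
    simpa using this
  have hTn : ∀ x n, |T x n| ≤ ‖T‖ * ‖x‖ := fun x n =>
    ((T x).toBCF.norm_coe_le_norm n).trans (by
      rw [ZeroAtInftyContinuousMap.norm_toBCF_eq_norm]
      exact T.le_opNorm x)
  let f : ℕ → StrongDual ℝ X := fun n => LinearMap.mkContinuous
    { toFun := fun x => T x n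
      map_add' := fun x y => by simp
      map_smul' := fun c x => by simp } ‖T‖ fun x => hTn x n
  have hfn : ∀ n, ‖f n‖ ≤ ‖T‖ := fun n => LinearMap.mkContinuous_norm_le _ hM.le _
  have hf0 : ∀ x, Tendsto (fun n => f n x) atTop (𝓝 0) := by
    intro x
    have := (T x).zero_at_infty'
    rw [cocompact_eq_cofinite, Nat.cofinite_eq_atTop] at this
    exact this
  obtain ⟨F, hFJ, hFn, hFw⟩ := exists_dual_extension_tendsto_zero (J.comp i) f hfn hf0
    (fun j => w j.unpair.1 j.unpair.2)
  have hFw' : ∀ m j, Tendsto (fun n => F n (w m j)) atTop (𝓝 0) := fun m j => by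
    simpa using hFw (Nat.pair m j)
  -- The remainder contributes `2‖T‖ · 1/8` and the finite-rank part at most `‖T‖/4`, uniformly in
  -- `x`.
  have key : ∀ m, ∀ᶠ n in atTop, ∀ x, |F n (Q m (i x))| ≤ 1 / 2 * ‖T‖ * ‖x‖ := by
    intro m
    have hs : Tendsto (fun n => ∑ j ∈ Finset.range m, ‖g j‖ * |F n (w m j)|) atTop (𝓝 0) := by
      have := tendsto_finsetSum (Finset.range m)
        fun j _ => ((hFw' m j).abs.const_mul ‖g j‖)
      simpa using this
    filter_upwards [hs.eventually_le_const (show (0 : ℝ) < ‖T‖ / 4 by positivity)] with n hn x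
    have h1 : |F n (Q m (i x) - ∑ j ∈ Finset.range m, g j x • w m j)| ≤
        2 * ‖T‖ * (1 / 8 * ‖x‖) :=
      (F n).le_of_opNorm_le_of_le (hFn n) (hw m x)
    have h2 : |F n (∑ j ∈ Finset.range m, g j x • w m j)| ≤ ‖T‖ / 4 * ‖x‖ := by
      rw [map_sum]
      refine (Finset.abs_sum_le_sum_abs _ _).trans ?_
      refine le_trans ?_ (mul_le_mul_of_nonneg_right hn (norm_nonneg x))
      rw [Finset.sum_mul]
      refine Finset.sum_le_sum fun j _ => ?_
      rw [map_smul, smul_eq_mul, abs_mul]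
      have := mul_le_mul_of_nonneg_right ((g j).le_opNorm x) (abs_nonneg (F n (w m j)))
      rw [Real.norm_eq_abs] at this
      linarith
    rw [map_sub] at h1
    have h3 := abs_add_le (F n (Q m (i x)) - F n (∑ j ∈ Finset.range m, g j x • w m j))
      (F n (∑ j ∈ Finset.range m, g j x • w m j))
    rw [sub_add_cancel] at h3
    linarith
  -- `Q 0 = 0` makes `k n = 0` admissible for the early `n`.
  obtain ⟨k, hk, hP⟩ := exists_tendsto_atTop_diagonal (by
    intro n x
    rw [hQ0]
    simp only [zero_apply, map_zero, abs_zero]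
    positivity) key
  obtain ⟨S, hS, hSn⟩ := exists_clm_zeroAtInfty_of_tendsto
    (fun n => (F n).comp (J.toContinuousLinearMap - Q (k n))) (C := 4 * ‖T‖) (by positivity)
    (fun n => by
      have h1 : ‖J.toContinuousLinearMap - Q (k n)‖ ≤ 2 :=
        (norm_sub_le _ _).trans (by linarith [J.norm_toContinuousLinearMap_le, hQ (k n)])
      refine ((F n).opNorm_comp_le _).trans ?_
      nlinarith [mul_le_mul (hFn n) h1 (norm_nonneg _) (by positivity)])
    (fun e => by
      have h1 : Tendsto (fun n => 2 * ‖T‖ * ‖J e - Q (k n) e‖) atTop (𝓝 0) := by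
        have := (((hQJ e).comp hk).const_sub (J e)).norm.const_mul (2 * ‖T‖)
        simpa using this
      exact squeeze_zero_norm (fun n => (F n).le_of_opNorm_le (hFn n) _) h1)
  refine ⟨S, hSn, fun x => ?_⟩
  rw [← ZeroAtInftyContinuousMap.norm_toBCF_eq_norm,
    BoundedContinuousFunction.norm_le (by positivity)]
  intro n
  have h1 : T x n - S (i x) n = F n (Q (k n) (i x)) := by
    have h2 : F n (J (i x)) = T x n := hFJ n x
    simp [hS, h2]
  change ‖T x n - S (i x) n‖ ≤ _
  rw [h1]
  exact hP n x

/-- An operator between normed spaces which is almost onto, uniformly, is onto. -/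
theorem exists_preimage_of_approx_preimage {V W : Type*} [NormedAddCommGroup V]
    [NormedSpace ℝ V] [CompleteSpace V] [NormedAddCommGroup W] [NormedSpace ℝ W]
    (r : V →L[ℝ] W) {C : ℝ} (h : ∀ T, ∃ S, ‖S‖ ≤ C * ‖T‖ ∧ ‖T - r S‖ ≤ 1 / 2 * ‖T‖) (T : W) :
    ∃ S, r S = T ∧ ‖S‖ ≤ 2 * C * ‖T‖ := by
  rcases eq_or_ne T 0 with rfl | hT
  · exact ⟨0, by simp, by simp⟩
  have hC : 0 ≤ C := by
    obtain ⟨S, hS, -⟩ := h T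
    exact nonneg_of_mul_nonneg_left ((norm_nonneg S).trans hS) (norm_pos_iff.2 hT)
  choose s hs hr using h
  -- The successive errors; each is at most half the previous one.
  let t : ℕ → W := fun n => n.rec T fun _ y => y - r (s y)
  have ht : ∀ n, ‖t n‖ ≤ ‖T‖ * (1 / 2) ^ n := by
    intro n
    induction n with
    | zero => simp [t]
    | succ n ih =>
      have := hr (t n)
      change ‖t n - r (s (t n))‖ ≤ _
      rw [pow_succ]
      linarith
  have hst : ∀ n, ‖s (t n)‖ ≤ C * ‖T‖ * (1 / 2) ^ n := fun n =>
    (hs (t n)).trans (by rw [mul_assoc]; exact mul_le_mul_of_nonneg_left (ht n) hC)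
  have hgeo : HasSum (fun n : ℕ => C * ‖T‖ * (1 / 2 : ℝ) ^ n) (C * ‖T‖ * 2) :=
    hasSum_geometric_two.mul_left _
  have hsum : Summable fun n => s (t n) := Summable.of_norm_bounded hgeo.summable hst
  have hpart : ∀ n, r (∑ j ∈ Finset.range n, s (t j)) = T - t n := by
    intro n
    induction n with
    | zero => simp [t]
    | succ n ih =>
      rw [Finset.sum_range_succ, map_add, ih]
      change _ = T - (t n - r (s (t n)))
      abel
  refine ⟨∑' n, s (t n), ?_, ?_⟩
  · have h1 := (r.continuous.tendsto _).comp hsum.hasSum.tendsto_sum_nat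
    have h2 : Tendsto t atTop (𝓝 0) := by
      refine squeeze_zero_norm ht ?_
      simpa using (tendsto_pow_atTop_nhds_zero_of_lt_one (r := (1 / 2 : ℝ)) (by norm_num)
        (by norm_num)).const_mul ‖T‖
    refine tendsto_nhds_unique h1 ?_
    simpa [Function.comp_def, hpart] using h2.const_sub T
  · exact (tsum_of_norm_bounded hgeo hst).trans (by linarith)

/-- If operators into a Banach space extend approximately, then they extend. -/
theorem exists_extension_of_approx_extension {X E Z : Type*} [NormedAddCommGroup X]
    [NormedSpace ℝ X] [NormedAddCommGroup E] [NormedSpace ℝ E] [NormedAddCommGroup Z]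
    [NormedSpace ℝ Z] [CompleteSpace Z] (i : X →ₗᵢ[ℝ] E) {C : ℝ}
    (h : ∀ T : X →L[ℝ] Z, ∃ S : E →L[ℝ] Z, ‖S‖ ≤ C * ‖T‖ ∧
      ∀ x, ‖T x - S (i x)‖ ≤ 1 / 2 * ‖T‖ * ‖x‖) (T : X →L[ℝ] Z) :
    ∃ S : E →L[ℝ] Z, (∀ x, S (i x) = T x) ∧ ‖S‖ ≤ 2 * C * ‖T‖ := by
  obtain ⟨S, hS, hSn⟩ := exists_preimage_of_approx_preimage
    (ContinuousLinearMap.precomp Z i.toContinuousLinearMap) (fun T => by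
      obtain ⟨S, hSn, hS⟩ := h T
      exact ⟨S, hSn, ContinuousLinearMap.opNorm_le_bound _ (by positivity) hS⟩) T
  exact ⟨S, fun x => DFunLike.congr_fun hS x, hSn⟩

/-! ### Order retractions of a compact line. -/

/-- A type with the discrete topology. -/
def Discretization (K : Type*) : Type _ := K

instance (K : Type*) : TopologicalSpace (Discretization K) := ⊥

instance (K : Type*) : DiscreteTopology (Discretization K) := ⟨rfl⟩

section CompactLine

variable {K : Type*} [TopologicalSpace K] [CompactSpace K]

/-- The isometric inclusion of `C(K)` into the bounded functions on `K`. -/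
noncomputable def boundedFunctionInclusion (K : Type*) [TopologicalSpace K] [CompactSpace K] :
    C(K, ℝ) →ₗᵢ[ℝ] (Discretization K →ᵇ ℝ) where
  toFun f := BoundedContinuousFunction.ofNormedAddCommGroupDiscrete (fun u : Discretization K => f u)
    ‖f‖ fun u => f.norm_coe_le_norm u
  map_add' _ _ := rfl
  map_smul' _ _ := rfl
  norm_map' f := by
    refine le_antisymm ((BoundedContinuousFunction.norm_le (norm_nonneg _)).2
      fun u => f.norm_coe_le_norm u) ((ContinuousMap.norm_le _ (norm_nonneg _)).2 fun u => ?_)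
    exact BoundedContinuousFunction.norm_coe_le_norm
      (BoundedContinuousFunction.ofNormedAddCommGroupDiscrete (fun u : Discretization K => f u)
        ‖f‖ fun u => f.norm_coe_le_norm u) u

/-- The operator of composition with a map defined on a part of `K`, extended by zero. -/
theorem exists_composition_operator (ρ : K → Option K) :
    ∃ Q : C(K, ℝ) →L[ℝ] (Discretization K →ᵇ ℝ), ‖Q‖ ≤ 1 ∧
      ∀ f (u : K), Q f u = (ρ u).elim 0 f := by
  have hb : ∀ (f : C(K, ℝ)) (u : K), ‖(ρ u).elim 0 f‖ ≤ ‖f‖ := by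
    intro f u
    cases ρ u with
    | none => simp
    | some v => exact f.norm_coe_le_norm v
  let L : C(K, ℝ) →ₗ[ℝ] (Discretization K →ᵇ ℝ) :=
    { toFun := fun f => BoundedContinuousFunction.ofNormedAddCommGroupDiscrete
        (fun u : Discretization K => (ρ u).elim 0 f) ‖f‖ (hb f)
      map_add' := fun f g => by
        ext u
        change (ρ u).elim 0 (f + g) = (ρ u).elim 0 f + (ρ u).elim 0 g
        cases ρ u <;> simp
      map_smul' := fun c f => by
        ext u
        change (ρ u).elim 0 (c • f) = c • (ρ u).elim 0 f
        cases ρ u <;> simp }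
  have hL : ∀ f, ‖L f‖ ≤ 1 * ‖f‖ := fun f => by
    rw [one_mul]
    exact (BoundedContinuousFunction.norm_le (norm_nonneg _)).2 (hb f)
  exact ⟨L.mkContinuous 1 hL, L.mkContinuous_norm_le zero_le_one hL, fun _ _ => rfl⟩

variable [LinearOrder K] [OrderTopology K]

/-- In a compact line, a nonempty closed set is the image of a retraction which respects the
order relative to points of the closed set. -/
theorem IsClosed.exists_order_retract {C : Set K} (hC : IsClosed C) (hne : C.Nonempty) (u : K) :
    ∃ v ∈ C, ∀ s ∈ C, (u ≤ s → v ≤ s) ∧ (s ≤ u → s ≤ v) := by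
  -- Move `u` up to the next point of `C`, or down to the maximum of `C` if there is none above.
  by_cases h : (C ∩ Set.Ici u).Nonempty
  · obtain ⟨v, hv, hmin⟩ := (hC.inter isClosed_Ici).isCompact.exists_isLeast h
    exact ⟨v, hv.1, fun s hs => ⟨fun hus => hmin ⟨hs, hus⟩, fun hsu => hsu.trans hv.2⟩⟩
  · obtain ⟨v, hv, hmax⟩ := hC.isCompact.exists_isGreatest hne
    exact ⟨v, hv, fun s hs => ⟨fun hus => absurd ⟨s, hs, hus⟩ h, fun _ => hmax hs⟩⟩

/-- A continuous function on a compact line is almost invariant under displacements which respect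
a suitable finite set of points. -/
theorem ContinuousMap.exists_finite_order_control (f : C(K, ℝ)) {ε : ℝ} (hε : 0 < ε) :
    ∃ S : Set K, S.Finite ∧ ∀ u, (∃ s, s ∈ S) ∧
      ∀ v, (∀ s ∈ S, (u ≤ s → v ≤ s) ∧ (s ≤ u → s ≤ v)) → |f v - f u| ≤ ε := by
  have hloc : ∀ p : K, ∃ b c : K, Set.Icc b c ∈ 𝓝 p ∧
      ∀ u ∈ Set.Icc b c, ∀ v ∈ Set.Icc b c, |f v - f u| ≤ ε := by
    intro p
    obtain ⟨b, c, -, hn, hsub⟩ := exists_Icc_mem_subset_of_mem_nhds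
      (Metric.tendsto_nhds.1 (f.continuous.tendsto p) (ε / 2) (by positivity))
    have hsub : ∀ u ∈ Set.Icc b c, |f u - f p| < ε / 2 := fun u hu => hsub hu
    refine ⟨b, c, hn, fun u hu v hv => ?_⟩
    have hu' := abs_lt.1 (hsub u hu)
    have hv' := abs_lt.1 (hsub v hv)
    exact abs_le.2 ⟨by linarith, by linarith⟩
  choose b c hn hosc using hloc
  obtain ⟨t, ht⟩ := CompactSpace.elim_nhds_subcover (fun p => Set.Icc (b p) (c p)) hn
  -- Respecting the endpoints of a finite cover by intervals of small oscillation keeps `v` in an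
  -- interval that contains `u`.
  refine ⟨b '' t ∪ c '' t, (t.finite_toSet.image b).union (t.finite_toSet.image c), fun u => ?_⟩
  have hu : u ∈ ⋃ p ∈ t, Set.Icc (b p) (c p) := by rw [ht]; trivial
  obtain ⟨p, hp, hup⟩ := Set.mem_iUnion₂.1 hu
  have hb : b p ∈ b '' t ∪ c '' t := Or.inl ⟨p, hp, rfl⟩
  have hc : c p ∈ b '' t ∪ c '' t := Or.inr ⟨p, hp, rfl⟩
  exact ⟨⟨_, hb⟩, fun v hv => hosc p u hup v ⟨(hv _ hb).2 hup.1, (hv _ hc).1 hup.2⟩⟩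

/-- The order retractions onto an increasing sequence of closed sets exhausting a compact line. -/
theorem exists_order_retraction_operators (C : ℕ → Set K) (hC : ∀ m, IsClosed (C m))
    (hmono : Monotone C) (hcover : ∀ t, ∃ m, t ∈ C m) :
    ∃ Q : ℕ → C(K, ℝ) →L[ℝ] (Discretization K →ᵇ ℝ), (∀ m, ‖Q m‖ ≤ 1) ∧
      (∀ f, Tendsto (fun m => Q m f) atTop (𝓝 (boundedFunctionInclusion K f))) ∧
      ∀ m (u : K), (∀ f, Q m f u = 0) ∧ C m = ∅ ∨ ∃ v ∈ C m, ∀ f, Q m f u = f v := by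
  have hρ : ∀ m (u : K), ∃ o : Option K, (o = none ∧ C m = ∅) ∨
      ∃ v ∈ C m, o = some v ∧ ∀ s ∈ C m, (u ≤ s → v ≤ s) ∧ (s ≤ u → s ≤ v) := by
    intro m u
    rcases (C m).eq_empty_or_nonempty with h | h
    · exact ⟨none, Or.inl ⟨rfl, h⟩⟩
    · obtain ⟨v, hv, hv'⟩ := (hC m).exists_order_retract h u
      exact ⟨some v, Or.inr ⟨v, hv, rfl, hv'⟩⟩
  choose ρ hρ using hρ
  choose Q hQn hQ using fun m => exists_composition_operator (ρ m)
  refine ⟨Q, hQn, fun f => ?_, fun m u => ?_⟩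
  · rw [Metric.tendsto_nhds]
    intro ε hε
    obtain ⟨S, hSf, hS⟩ := f.exists_finite_order_control (half_pos hε)
    have hev : ∀ᶠ m in atTop, ∀ s ∈ S, s ∈ C m := by
      refine (hSf.eventually_all).2 fun s _ => ?_
      obtain ⟨m, hm⟩ := hcover s
      filter_upwards [eventually_ge_atTop m] with n hn
      exact hmono hn hm
    filter_upwards [hev] with m hm
    refine lt_of_le_of_lt ?_ (half_lt_self hε)
    rw [dist_eq_norm, BoundedContinuousFunction.norm_le (half_pos hε).le]
    intro u
    obtain ⟨⟨s, hs⟩, hu⟩ := hS u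
    rcases hρ m u with ⟨-, h⟩ | ⟨v, -, hv, hv'⟩
    · exact absurd (hm s hs) (by simp [h])
    · have h1 : Q m f u = f v := (hQ m f u).trans (congrArg (fun o => o.elim 0 f) hv)
      change |Q m f u - f u| ≤ _
      rw [h1]
      exact hu v fun s hs => hv' s (hm s hs)
  · rcases hρ m u with ⟨h, h'⟩ | ⟨v, hv, h, -⟩
    · exact Or.inl ⟨fun f => (hQ m f u).trans (congrArg (fun o => o.elim 0 f) h), h'⟩
    · exact Or.inr ⟨v, hv, fun f => (hQ m f u).trans (congrArg (fun o => o.elim 0 f) h)⟩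

end CompactLine

/-! ### Separable duals and the extension theorem. -/

theorem BoundedContinuousFunction.sub_sum_smul_apply {α ι : Type*} [TopologicalSpace α]
    (q : α →ᵇ ℝ) (s : Finset ι) (c : ι → ℝ) (w : ι → α →ᵇ ℝ) (u : α) :
    (q - ∑ j ∈ s, c j • w j) u = q u - ∑ j ∈ s, c j * w j u := by
  simp

/-- If `X ⊆ C(K)` has separable dual, then `K` is a countable union of closed sets on each of which
the evaluations are close to a fixed functional on `X`. -/
theorem exists_closed_cover_of_separable_dual {K X : Type*} [TopologicalSpace K] [CompactSpace K]
    [NormedAddCommGroup X] [NormedSpace ℝ X]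
    [TopologicalSpace.SeparableSpace (StrongDual ℝ X)] (ι : X →ₗᵢ[ℝ] C(K, ℝ)) :
    ∃ (g : ℕ → StrongDual ℝ X) (A : ℕ → Set K), (∀ i, IsClosed (A i)) ∧ (∀ t, ∃ i, t ∈ A i) ∧
      ∀ i, ∀ t ∈ A i, ∀ x : X, |ι x t - g i x| ≤ 1 / 8 * ‖x‖ := by
  let g : ℕ → StrongDual ℝ X := TopologicalSpace.denseSeq (StrongDual ℝ X)
  let A : ℕ → Set K := fun i => {t | ∀ x : X, |ι x t - g i x| ≤ 1 / 8 * ‖x‖}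
  have hA : ∀ i, IsClosed (A i) := by
    intro i
    simp only [A, Set.ofPred_forall]
    exact isClosed_iInter fun x => isClosed_le
      (((ι x).continuous.sub continuous_const).abs) continuous_const
  have hAc : ∀ t, ∃ i, t ∈ A i := by
    intro t
    let d : StrongDual ℝ X := (ContinuousMap.evalCLM ℝ t).comp ι.toContinuousLinearMap
    obtain ⟨_, hi, ⟨i, rfl⟩⟩ := Metric.dense_iff.1 (TopologicalSpace.denseRange_denseSeq
      (StrongDual ℝ X)) d (1 / 8) (by norm_num)
    rw [mem_ball_iff_norm'] at hi
    exact ⟨i, fun x => (d - g i).le_of_opNorm_le hi.le x⟩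
  exact ⟨g, A, hA, hAc, fun _ _ h => h⟩

/-- If `X ⊆ C(K)` has separable dual, then the inclusion of `C(K)` into the bounded functions is a
strong limit of contractions whose restrictions to `X` are nearly of finite rank. -/
theorem exists_nearly_finite_rank_approximation {K X : Type*} [LinearOrder K] [TopologicalSpace K]
    [OrderTopology K] [CompactSpace K] [NormedAddCommGroup X]
    [NormedSpace ℝ X] [TopologicalSpace.SeparableSpace (StrongDual ℝ X)] (ι : X →ₗᵢ[ℝ] C(K, ℝ)) :
    ∃ (Q : ℕ → C(K, ℝ) →L[ℝ] (Discretization K →ᵇ ℝ)) (g : ℕ → StrongDual ℝ X)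
      (w : ℕ → ℕ → (Discretization K →ᵇ ℝ)), (∀ m, ‖Q m‖ ≤ 1) ∧ Q 0 = 0 ∧
      (∀ f, Tendsto (fun m => Q m f) atTop (𝓝 (boundedFunctionInclusion K f))) ∧
      ∀ m (x : X), ‖Q m (ι x) - ∑ j ∈ Finset.range m, g j x • w m j‖ ≤
        1 / 8 * ‖x‖ := by
  obtain ⟨g, A, hA, hAc, hAg⟩ := exists_closed_cover_of_separable_dual ι
  let C : ℕ → Set K := fun m => ⋃ i ∈ Finset.range m, A i
  obtain ⟨Q, hQn, hQl, hQ⟩ := exists_order_retraction_operators C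
    (fun m => isClosed_biUnion_finset fun i _ => hA i)
    (fun m n hmn => Set.biUnion_subset_biUnion_left fun i hi =>
      Finset.mem_range.2 ((Finset.mem_range.1 hi).trans_le hmn))
    (fun t => by
      obtain ⟨i, hi⟩ := hAc t
      exact ⟨i + 1, Set.mem_biUnion (Finset.self_mem_range_succ i) hi⟩)
  have hQ0 : Q 0 = 0 := by
    ext f u
    rcases hQ 0 u with ⟨h, -⟩ | ⟨v, hv, -⟩
    · exact h f
    · simp [C] at hv
  have hw : ∀ m (u : K), ∃ a : ℕ → ℝ, (∀ i, |a i| ≤ 1) ∧ ∀ x : X,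
      |Q m (ι x) u - ∑ i ∈ Finset.range m, g i x * a i| ≤ 1 / 8 * ‖x‖ := by
    intro m u
    rcases hQ m u with ⟨h, -⟩ | ⟨v, hv, h⟩
    · exact ⟨0, by simp, fun x => by rw [h]; simp⟩
    · obtain ⟨i, hi, hvi⟩ := Set.mem_iUnion₂.1 hv
      -- The retract `v` of `u` lies in `A i`, so `g i` alone approximates evaluation at `v`.
      refine ⟨Pi.single i 1, fun j => ?_, fun x => ?_⟩
      · by_cases hj : j = i
        · subst hj; simp
        · simp [hj]
      · rw [h, Finset.sum_eq_single_of_mem i hi (fun j _ hj => by simp [hj])]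
        simpa using hAg i v hvi x
  choose a ha1 ha using hw
  let w : ℕ → ℕ → (Discretization K →ᵇ ℝ) := fun m i =>
    BoundedContinuousFunction.ofNormedAddCommGroupDiscrete
      (fun u : Discretization K => a m u i) 1 fun u => ha1 m u i
  have happ : ∀ m (x : X), ‖Q m (ι x) - ∑ j ∈ Finset.range m, g j x • w m j‖ ≤
      1 / 8 * ‖x‖ := by
    intro m x
    rw [BoundedContinuousFunction.norm_le (by positivity)]
    intro u
    have h1 := ha m u x
    rw [BoundedContinuousFunction.sub_sum_smul_apply]
    exact h1
  exact ⟨Q, g, w, hQn, hQ0, hQl, happ⟩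

/-- Operators into `c₀` from a subspace of `C(K)` with separable dual extend to `C(K)`. -/
theorem exists_c0_extension_of_separable_dual {K X : Type*} [LinearOrder K] [TopologicalSpace K]
    [OrderTopology K] [CompactSpace K] [NormedAddCommGroup X] [NormedSpace ℝ X]
    [TopologicalSpace.SeparableSpace (StrongDual ℝ X)] (ι : X →ₗᵢ[ℝ] C(K, ℝ))
    (T : X →L[ℝ] C₀(ℕ, ℝ)) :
    ∃ S : C(K, ℝ) →L[ℝ] C₀(ℕ, ℝ), (∀ x, S (ι x) = T x) ∧ ‖S‖ ≤ 8 * ‖T‖ := by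
  obtain ⟨Q, g, w, hQn, hQ0, hQl, happ⟩ := exists_nearly_finite_rank_approximation ι
  obtain ⟨S, hS, hSn⟩ := exists_extension_of_approx_extension ι (C := 4)
    (exists_approx_extension ι (boundedFunctionInclusion K) Q hQn hQ0 hQl g w happ) T
  refine ⟨S, hS, hSn.trans (le_of_eq ?_)⟩
  norm_num

theorem theorem2p3 {K : Type*} [LinearOrder K] [TopologicalSpace K] [OrderTopology K]
    [CompactSpace K] (X : NormedSubspace C(K, ℝ)) (hX : IsClosed (X : Set C(K, ℝ)))
    (hdual : TopologicalSpace.SeparableSpace (StrongDual ℝ X)) :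
    HasC0ExtensionProperty X ∧
      ∀ (T : X →L[ℝ] C₀(ℕ, ℝ)) (ε : ℝ), 0 < ε →
        ∃ T' : C(K, ℝ) →L[ℝ] C₀(ℕ, ℝ),
          (∀ x : X, T' (x : C(K, ℝ)) = T x) ∧ ‖T'‖ ≤ (8 + ε) * ‖T‖ := by
  have main := exists_c0_extension_of_separable_dual X.subtypeₗᵢ
  refine ⟨fun T => ?_, fun T ε hε => ?_⟩
  · obtain ⟨S, hS, -⟩ := main T
    exact ⟨S, hS⟩
  · obtain ⟨S, hS, hSn⟩ := main T
    exact ⟨S, hS, hSn.trans (mul_le_mul_of_nonneg_right (by linarith) (ContinuousLinearMap.opNorm_nonneg T))⟩
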